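/- Let $M$ be a matroid of rank $r$ on the ground set $[n]=\{1,\dots,n\}$ with set of bases $\mathcal{B}$, and let $H\subseteq[n]$ be a stressed hyperplane of $M$ with $|H|=s$; that is, $H$ is a flat of rank $r-1$ all of whose $(r-1)$-element subsets are independent. Let $\mathrm{Rel}_H(M)$ be the relaxation of $M$ at $H$, i.e. the matroid on $[n]$ with set of bases $\mathcal{B}\cup\binom{H}{r}$ (this is indeed a matroid). For a matroid $N$ on $[n]$ let $\mathcal{P}_N=\mathrm{conv}\{\mathbf{e}_B : B \text{ a basis of } N\}\subset\mathbb{R}^n$ be its base polytope, where $\mathbf{e}_B=\sum_{i\in B}\mathbf{e}_i$, and let $\mathrm{ehr}_N(t)=|t\mathcal{P}_N\cap\mathbb{Z}^n|$. Then for every integer $t\ge 0$ $$\mathrm{ehr}_{\mathrm{Rel}_H(M)}(t)=\mathrm{ehr}_M(t)+\sum_{m=0}^{t-1}\sum_{i=0}^{s-r}(-1)^i\binom{s}{i}\binom{t(s-r-i)+m+s-1-i}{s-1}\binom{m+n-s-1}{m},$$ where an empty sum is $0$ (in particular the inner sum is empty if $s=r-1$). Moreover, suppose $r\le s$, and let $\mathrm{Pan}$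 be the panhandle matroid of rank $r$ on $[n]$ with respect to $H$, whose bases are the $r$-element sets $B\subseteq[n]$ with $|B\cap H|\ge r-1$ (this is $\mathrm{Pan}_{r,s,n}$ if $H=[s]$). Then $$\mathcal{P}_{\mathrm{Rel}_H(M)}=\mathcal{P}_M\cup\mathcal{P}_{\mathrm{Pan}},\qquad \mathcal{P}_M\cap\mathcal{P}_{\mathrm{Pan}}=\Big\{x\in[0,1]^n:\ \sum_{i=1}^n x_i=r,\ \sum_{i\notin H}x_i=1\Big\},$$ and this intersection is a (possibly improper) face of both $\mathcal{P}_M$ and $\mathcal{P}_{\mathrm{Pan}}$. -/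

import Mathlib

open Set
open scoped Pointwise

namespace Matroid

/-- A hyperplane of a matroid of rank `r` is a flat of rank `r - 1`. -/
def IsHyperplane {α : Type*} (M : Matroid α) (H : Set α) : Prop :=
  M.IsFlat H ∧ M.eRk H + 1 = M.eRank

/-- A hyperplane `H` of a matroid of rank `r` is stressed if every subset of `H` with `r - 1`
elements is independent. -/
def IsStressedHyperplane {α : Type*} (M : Matroid α) (H : Set α) : Prop :=
  M.IsHyperplane H ∧ ∀ I ⊆ H, I.encard + 1 = M.eRank → M.Indep I

/-- The exchange axiom for the bases of `M` together with the `r`-subsets of a stressed hyperplane,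
where `r` is the rank of `M`. -/
theorem IsStressedHyperplane.exchange {α : Type*} {M : Matroid α} [M.Finite] {H : Set α}
    (hH : M.IsStressedHyperplane H) :
    ExchangeProperty (fun B : Set α => M.IsBase B ∨ (B ⊆ H ∧ B.encard = M.eRank)) := by
  have hHE : H ⊆ M.E := hH.1.1.subset_ground
  have hcard : ∀ B, (M.IsBase B ∨ (B ⊆ H ∧ B.encard = M.eRank)) → B.encard = M.eRank := by
    rintro B (h | h)
    · exact h.encard_eq_eRank
    · exact h.2
  have hfin : ∀ B, (M.IsBase B ∨ (B ⊆ H ∧ B.encard = M.eRank)) → B.Finite := by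
    rintro B (h | h)
    · exact h.finite
    · exact M.ground_finite.subset (h.1.trans hHE)
  have hnt : M.eRank ≠ ⊤ := M.eRank_ne_top_iff.2 inferInstance
  intro B₁ B₂ h₁ h₂ e he
  have hc₁ := hcard _ h₁
  have hc₂ := hcard _ h₂
  -- any independent set of full size is a base
  have hbase : ∀ I, M.Indep I → M.eRank ≤ I.encard → M.IsBase I := by
    intro I hI hle
    exact hI.isBase_of_eRk_ge (M.ground_finite.subset hI.subset_ground)
      (by rw [hI.eRk_eq_encard]; exact hle)
  have hdiff : (B₁ \ {e}).encard + 1 = M.eRank := by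
    rw [encard_sdiff_singleton_add_one he.1, hc₁]
  have hins : ∀ f, f ∉ B₁ → (insert f (B₁ \ {e})).encard = M.eRank := by
    intro f hf
    rw [encard_insert_of_notMem (fun h => hf h.1), hdiff]
  -- there is always some element of `B₂` outside `B₁`
  have hne : ∃ f ∈ B₂, f ∉ B₁ := by
    by_contra! hcon
    have : B₂ = B₁ := (hfin _ h₂).eq_of_subset_of_encard_le (fun x hx => hcon x hx)
      (hc₁.trans hc₂.symm).le
    exact he.2 (this ▸ he.1)
  -- `f ∈ B₂` outside `B₁ \ {e}` is outside `B₁`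
  have hout : ∀ f ∈ B₂, f ∉ B₁ \ {e} → f ∉ B₁ := by
    intro f hf hfn hf₁
    exact hfn ⟨hf₁, fun h => he.2 (h ▸ hf)⟩
  by_cases hsub : B₁ \ {e} ⊆ H
  · have hI : M.Indep (B₁ \ {e}) := hH.2 _ hsub hdiff
    rcases h₂ with h₂ | h₂
    · have hnb : ¬ M.IsBase (B₁ \ {e}) := by
        intro hb
        have h1 := hb.encard_eq_eRank
        rw [← h1] at hdiff hnt
        exact absurd hdiff (by lift (B₁ \ {e}).encard to ℕ using hnt with k; norm_cast; omega)
      obtain ⟨f, hf, hfi⟩ := hI.exists_insert_of_not_isBase hnb h₂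
      have hf₁ := hout f hf.1 hf.2
      exact ⟨f, ⟨hf.1, hf₁⟩, Or.inl (hbase _ hfi (hins f hf₁).ge)⟩
    · obtain ⟨f, hf₂, hf₁⟩ := hne
      exact ⟨f, ⟨hf₂, hf₁⟩, Or.inr ⟨insert_subset (h₂.1 hf₂) hsub, hins f hf₁⟩⟩
  · -- then `B₁` is a base of `M`
    have hb₁ : M.IsBase B₁ := by
      rcases h₁ with h₁ | h₁
      · exact h₁
      · exact absurd (sdiff_subset.trans h₁.1) hsub
    rcases h₂ with h₂ | h₂
    · obtain ⟨f, hf, hfb⟩ := hb₁.exchange h₂ he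
      exact ⟨f, hf, Or.inl hfb⟩
    · have hI : M.Indep (B₁ \ {e}) := hb₁.indep.subset sdiff_subset
      by_cases hcl : B₂ ⊆ M.closure (B₁ \ {e})
      · exfalso
        obtain ⟨g, hg⟩ := hne
        -- an `(r-1)`-subset `J` of `B₂` is independent and spans both sets
        have hJ1 : (B₂ \ {g}).encard + 1 = M.eRank := by
          rw [encard_sdiff_singleton_add_one hg.1, hc₂]
        have hJH : B₂ \ {g} ⊆ H := sdiff_subset.trans h₂.1
        have hJ : M.Indep (B₂ \ {g}) := hH.2 _ hJH hJ1
        have hJc : (B₂ \ {g}).encard = (B₁ \ {e}).encard := by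
          rw [← hdiff] at hJ1
          exact (ENat.add_left_injective_of_ne_top ENat.one_ne_top) hJ1
        have hle : M.closure (B₂ \ {g}) = M.closure (B₁ \ {e}) := by
          have h3 : B₂ \ {g} ⊆ M.closure (B₁ \ {e}) := sdiff_subset.trans hcl
          have hfr' : M.IsRkFinite (B₂ \ {g}) :=
            M.isRkFinite_of_finite ((hfin _ (Or.inr h₂)).subset sdiff_subset)
          have h5 := hfr'.closure_eq_closure_of_subset_of_eRk_ge_eRk h3
            (by rw [eRk_closure_eq, hI.eRk_eq_encard, hJ.eRk_eq_encard]; exact hJc.ge)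
          simpa using h5
        apply hsub
        calc B₁ \ {e} ⊆ M.closure (B₁ \ {e}) := M.subset_closure _ hI.subset_ground
          _ = M.closure (B₂ \ {g}) := hle.symm
          _ ⊆ M.closure H := M.closure_subset_closure hJH
          _ = H := hH.1.1.closure
      · obtain ⟨f, hf₂, hf⟩ := not_subset.1 hcl
        have hfE : f ∈ M.E := hHE (h₂.1 hf₂)
        have hfn : f ∉ B₁ \ {e} := fun h => hf (M.subset_closure _ hI.subset_ground h)
        have hf₁ := hout f hf₂ hfn
        refine ⟨f, ⟨hf₂, hf₁⟩, Or.inl (hbase _ ?_ (hins f hf₁).ge)⟩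
        rw [hI.insert_indep_iff]
        exact Or.inl ⟨hfE, hf⟩

/-- The relaxation of a matroid `M` of rank `r` at a stressed hyperplane `H`: the matroid on the
same ground set whose bases are the bases of `M` and the `r`-element subsets of `H`. -/
def relaxation {α : Type*} (M : Matroid α) [M.Finite] (H : Set α)
    (hH : M.IsStressedHyperplane H) : Matroid α :=
  Matroid.ofIsBaseOfFinite M.ground_finite
    (fun B => M.IsBase B ∨ (B ⊆ H ∧ B.encard = M.eRank))
    (M.exists_isBase.imp fun _ h => Or.inl h)
    hH.exchange
    (fun _ hB => hB.elim (fun h => h.subset_ground) fun h => h.1.trans hH.1.1.subset_ground)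

/-- The exchange axiom for the bases of a panhandle matroid. -/
theorem panhandle_exchange {α : Type*} [Finite α] (H : Set α) (r : ℕ) :
    ExchangeProperty (fun B : Set α => B.ncard = r ∧ r ≤ (B ∩ H).ncard + 1) := by
  intro B₁ B₂ h₁ h₂ e he
  have hins : ∀ f, f ∉ B₁ → (insert f (B₁ \ {e})).ncard = r := by
    intro f hf
    rw [ncard_exchange hf he.1, h₁.1]
  by_cases h : r ≤ ((B₁ \ {e}) ∩ H).ncard + 1
  · obtain ⟨f, hf₂, hf₁⟩ : ∃ f ∈ B₂, f ∉ B₁ := by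
      by_contra! hcon
      have : B₂ = B₁ := eq_of_subset_of_ncard_le hcon (by rw [h₁.1, h₂.1])
      exact he.2 (this ▸ he.1)
    refine ⟨f, ⟨hf₂, hf₁⟩, hins f hf₁, h.trans ?_⟩
    gcongr
    · exact toFinite _
    · exact subset_insert _ _
  · obtain ⟨f, hf₂, hf₁⟩ : ∃ f ∈ B₂ ∩ H, f ∉ B₁ := by
      by_contra! hcon
      apply h
      refine h₂.2.trans ?_
      have h0 : B₂ ∩ H ⊆ (B₁ \ {e}) ∩ H :=
        fun x hx => ⟨⟨hcon x hx, fun hxe => he.2 (hxe ▸ hx.1)⟩, hx.2⟩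
      have := ncard_le_ncard h0 (toFinite _)
      omega
    refine ⟨f, ⟨hf₂.1, hf₁⟩, hins f hf₁, h₁.2.trans ?_⟩
    have hsub : insert f ((B₁ ∩ H) \ {e}) ⊆ insert f (B₁ \ {e}) ∩ H := by
      rintro x (rfl | hx)
      · exact ⟨mem_insert _ _, hf₂.2⟩
      · exact ⟨Or.inr ⟨hx.1.1, hx.2⟩, hx.1.2⟩
    have h2 := ncard_le_ncard hsub (toFinite _)
    rw [ncard_insert_of_notMem (fun h => hf₁ h.1.1) (toFinite _)] at h2
    have h3 := ncard_le_ncard_sdiff_add_ncard (B₁ ∩ H) {e} (toFinite _)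
    rw [ncard_singleton] at h3
    omega

/-- The panhandle matroid of rank `r` with respect to a set `H` with at least `r` elements: its
bases are the `r`-element sets `B` with `|B ∩ H| ≥ r - 1`.  On the ground set `[n]` with `H = [s]`
this is the panhandle matroid `Pan_{r,s,n}`. -/
def panhandle {α : Type*} [Finite α] (H : Set α) (r : ℕ) (hr : r ≤ H.ncard) : Matroid α :=
  Matroid.ofIsBaseOfFinite (E := Set.univ) (toFinite _)
    (fun B => B.ncard = r ∧ r ≤ (B ∩ H).ncard + 1)
    (by
      obtain ⟨B, hB, hBr⟩ := exists_subset_card_eq hr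
      exact ⟨B, hBr, by rw [inter_eq_self_of_subset_left hB]; omega⟩)
    (panhandle_exchange H r)
    (fun _ _ => subset_univ _)

/-- The base polytope of a matroid: the convex hull of the indicator vectors of its bases. -/
noncomputable def basePolytope {α : Type*} (M : Matroid α) : Set (α → ℝ) :=
  convexHull ℝ ((fun B : Set α => B.indicator (fun _ => (1 : ℝ))) '' {B | M.IsBase B})

end Matroid

/-- The Ehrhart function of a polytope `P`: the number of integer points in the dilate `t P`. -/
noncomputable def ehrhart {ι : Type*} (P : Set (ι → ℝ)) (t : ℕ) : ℕ :=
  Set.ncard {z : ι → ℤ | (fun i => (z i : ℝ)) ∈ (t : ℝ) • P}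

/-! ### Integrality of hypersimplex slices. -/

section Slice

variable {ι : Type*} [Fintype ι] [DecidableEq ι]

/-! Let ℓ(x) be the coordinate sum outside `H`. Since `H` has rank r - 1, every basis of `M` has an
element off `H`; since `H` is also a stressed flat, every r-set with exactly one element off `H` is
a basis. Slices of the hypersimplex between integer levels of ℓ have 0/1 vertices
(`hypersimplexSlice_eq_convexHull`), so P_M lies in ℓ ≥ 1 and contains the whole slice ℓ = 1, while
P_Pan is the slice 0 ≤ ℓ ≤ 1. Relaxing adds only vertices with ℓ = 0, and a segment from P_M to such
a level crosses ℓ = 1 inside P_M (`segment_subset`). This gives the union, the intersection and the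
faces.

Hence P_Rel minus P_M is the half-open slice ℓ < 1. The integer points of its t-th dilate are sorted
by the level m < t of ℓ and counted as products: weak compositions of m off `H`, and bounded
compositions on `H` by inclusion-exclusion (`ncard_slice_int_points`). -/

/-- The points of the hypersimplex of rank `r` whose coordinate sum outside `H` lies between
`a` and `b`. -/
def hypersimplexSlice (H : Finset ι) (r a b : ℕ) : Set (ι → ℝ) :=
  {x | (∀ i, 0 ≤ x i ∧ x i ≤ 1) ∧ ∑ i, x i = r ∧ (a : ℝ) ≤ ∑ i ∈ Hᶜ, x i ∧ ∑ i ∈ Hᶜ, x i ≤ b}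

omit [Fintype ι] in
theorem sum_ne_intCast_of_unique_fractional {T : Finset ι} {x : ι → ℝ} {i : ι} (hi : i ∈ T)
    (hx : 0 < x i ∧ x i < 1) (hT : ∀ j ∈ T, j ≠ i → x j = 0 ∨ x j = 1) (k : ℤ) :
    ∑ j ∈ T, x j ≠ k := by
  obtain ⟨m, hm⟩ : ∃ m : ℤ, (m : ℝ) = ∑ j ∈ T.erase i, x j := by
    have h : ∑ j ∈ T.erase i, x j ∈ (Int.castAddHom ℝ).range := by
      refine sum_mem fun j hj => ?_
      rw [Finset.mem_erase] at hj
      rcases hT j hj.2 hj.1 with h | h <;> rw [h]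
      · exact ⟨0, by simp⟩
      · exact ⟨1, by simp⟩
    obtain ⟨m, hm⟩ := h
    exact ⟨m, hm⟩
  intro hk
  rw [← Finset.add_sum_erase T x hi, ← hm] at hk
  have h0 : (0 : ℝ) < ((k - m : ℤ) : ℝ) := by push_cast; linarith
  have h1 : ((k - m : ℤ) : ℝ) < 1 := by push_cast; linarith
  have h0' : 0 < k - m := by exact_mod_cast h0
  have h1' : k - m < 1 := by exact_mod_cast h1
  omega

/-- Otherwise x is the midpoint of x ± ε(e_i - e_j). The move keeps the total sum; it fixes ℓ if i
and j are on the same side of `H`, and otherwise the slack in both bounds on ℓ absorbs it. -/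
theorem not_two_fractional_of_mem_extremePoints {H : Finset ι} {r a b : ℕ} {x : ι → ℝ}
    (hx : x ∈ (hypersimplexSlice H r a b).extremePoints ℝ) {i j : ι} (hij : i ≠ j)
    (hi : 0 < x i ∧ x i < 1) (hj : 0 < x j ∧ x j < 1)
    (h : (i ∈ H ↔ j ∈ H) ∨ ((a : ℝ) < ∑ i ∈ Hᶜ, x i ∧ ∑ i ∈ Hᶜ, x i < b)) : False := by
  obtain ⟨⟨hx01, hxr, hxa, hxb⟩, hext⟩ := mem_extremePoints.1 hx
  -- The rate of change of ℓ along e_i - e_j.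
  set c : ℝ := (if i ∈ H then 0 else 1) - (if j ∈ H then 0 else 1) with hc
  have hc1 : |c| ≤ 1 := by
    rw [hc, abs_le]; split_ifs <;> norm_num
  obtain ⟨ε, hε, hεi, hεi', hεj, hεj', hεa, hεb⟩ : ∃ ε : ℝ, 0 < ε ∧ ε ≤ x i ∧ ε ≤ 1 - x i ∧
      ε ≤ x j ∧ ε ≤ 1 - x j ∧ |ε * c| ≤ ∑ i ∈ Hᶜ, x i - a ∧ |ε * c| ≤ b - ∑ i ∈ Hᶜ, x i := by
    set δ := min (min (x i) (1 - x i)) (min (x j) (1 - x j)) with hδ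
    have hδ0 : 0 < δ := by
      simp only [hδ, lt_min_iff, sub_pos]; exact ⟨hi, hj⟩
    have h1 : δ ≤ x i := (min_le_left _ _).trans (min_le_left _ _)
    have h2 : δ ≤ 1 - x i := (min_le_left _ _).trans (min_le_right _ _)
    have h3 : δ ≤ x j := (min_le_right _ _).trans (min_le_left _ _)
    have h4 : δ ≤ 1 - x j := (min_le_right _ _).trans (min_le_right _ _)
    rcases h with h | ⟨ha, hb⟩
    · have hc0 : c = 0 := by simp [hc, h]
      exact ⟨δ, hδ0, h1, h2, h3, h4, by rw [hc0]; simpa using hxa, by rw [hc0]; simpa using hxb⟩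
    · set η := min δ (min (∑ i ∈ Hᶜ, x i - a) (b - ∑ i ∈ Hᶜ, x i)) with hη
      have hη0 : 0 < η := by
        simp only [hη, lt_min_iff, sub_pos]; exact ⟨hδ0, ha, hb⟩
      have hηδ : η ≤ δ := min_le_left _ _
      have hle : |η * c| ≤ η := by
        rw [abs_mul, abs_of_pos hη0]; exact mul_le_of_le_one_right hη0.le hc1
      exact ⟨η, hη0, hηδ.trans h1, hηδ.trans h2, hηδ.trans h3, hηδ.trans h4,
        hle.trans ((min_le_right _ _).trans (min_le_left _ _)),
        hle.trans ((min_le_right _ _).trans (min_le_right _ _))⟩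
  have key : ∀ σ : ℝ, |σ| = ε →
      x + ((Pi.single i σ : ι → ℝ) - (Pi.single j σ : ι → ℝ)) ∈ hypersimplexSlice H r a b := by
    intro σ hσ
    obtain ⟨hσ1, hσ2⟩ := abs_le.1 hσ.le
    have hsum : ∑ k ∈ Hᶜ, (x + ((Pi.single i σ : ι → ℝ) - (Pi.single j σ : ι → ℝ))) k =
        ∑ k ∈ Hᶜ, x k + σ * c := by
      simp only [Pi.add_apply, Pi.sub_apply, Finset.sum_add_distrib, Finset.sum_sub_distrib,
        hc]
      split_ifs <;> simp_all
    have hab : |σ * c| = |ε * c| := by rw [abs_mul, abs_mul, hσ, abs_of_pos hε]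
    rw [← hab] at hεa hεb
    have hA := abs_le.1 hεa
    have hB := abs_le.1 hεb
    refine ⟨fun k => ?_, ?_, ?_, ?_⟩
    · have := hx01 k
      rcases eq_or_ne k i with rfl | hki
      · simp only [Pi.add_apply, Pi.sub_apply, Pi.single_eq_same, Pi.single_eq_of_ne hij]
        constructor <;> linarith
      · rcases eq_or_ne k j with rfl | hkj
        · simp only [Pi.add_apply, Pi.sub_apply, Pi.single_eq_same, Pi.single_eq_of_ne hki]
          constructor <;> linarith
        · simpa [hki, hkj] using this
    · simp [Finset.sum_add_distrib, hxr]
    · rw [hsum]; linarith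
    · rw [hsum]; linarith
  have h1 := key ε (abs_of_pos hε)
  have h2 := key (-ε) (by rw [abs_neg, abs_of_pos hε])
  have := (hext _ h1 _ h2 ⟨1 / 2, 1 / 2, by norm_num, by norm_num, by norm_num, by
    ext k
    simp only [Pi.single_neg, Pi.add_apply, Pi.smul_apply, Pi.sub_apply, Pi.neg_apply, smul_eq_mul]
    ring⟩).1
  have hk := congrFun this i
  simp [hij] at hk
  exact hε.ne' hk

/-- The integer total rules out a single fractional coordinate, and two on the same side of `H` are
excluded, so there is exactly one on each side. Then ℓ is not an integer, hence lies strictly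
between a and b, and this pair is excluded as well. -/
theorem eq_zero_or_one_of_mem_extremePoints {H : Finset ι} {r a b : ℕ} {x : ι → ℝ}
    (hx : x ∈ (hypersimplexSlice H r a b).extremePoints ℝ) (i : ι) : x i = 0 ∨ x i = 1 := by
  obtain ⟨hx01, hxr, hxa, hxb⟩ := hx.1
  by_contra! hi
  have frac : ∀ k, (x k ≠ 0 ∧ x k ≠ 1) → 0 < x k ∧ x k < 1 := fun k hk =>
    ⟨(hx01 k).1.lt_of_ne' hk.1, (hx01 k).2.lt_of_ne hk.2⟩
  obtain ⟨j, hji, hj⟩ : ∃ j, j ≠ i ∧ (x j ≠ 0 ∧ x j ≠ 1) := by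
    by_contra! hcon
    refine sum_ne_intCast_of_unique_fractional (Finset.mem_univ i) (frac i hi)
      (fun k _ hk => ?_) r (by simpa using hxr)
    by_cases h0 : x k = 0
    · exact Or.inl h0
    · exact Or.inr (hcon k hk h0)
  have hside : ¬ (i ∈ H ↔ j ∈ H) := fun h =>
    not_two_fractional_of_mem_extremePoints hx hji.symm (frac i hi) (frac j hj) (Or.inl h)
  have hint : ∃ k ∈ Hᶜ, (x k ≠ 0 ∧ x k ≠ 1) := by
    by_cases h : i ∈ H
    · exact ⟨j, by simp only [Finset.mem_compl]; tauto, hj⟩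
    · exact ⟨i, by simpa using h, hi⟩
  obtain ⟨k, hkH, hk⟩ := hint
  have hne := sum_ne_intCast_of_unique_fractional hkH (frac k hk) (fun l hl hlk => by
    by_contra! hl'
    refine not_two_fractional_of_mem_extremePoints hx hlk (frac l hl') (frac k hk) (Or.inl ?_)
    simp only [Finset.mem_compl] at hl hkH
    tauto)
  exact not_two_fractional_of_mem_extremePoints hx hji.symm (frac i hi) (frac j hj)
    (Or.inr ⟨hxa.lt_of_ne' (by simpa using hne a), hxb.lt_of_ne (by simpa using hne b)⟩)

omit [Fintype ι] [DecidableEq ι] in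
theorem sum_indicator_one_eq_ncard (T : Finset ι) (B : Set ι) :
    ∑ i ∈ T, B.indicator (fun _ => (1 : ℝ)) i = ((B ∩ T : Set ι).ncard : ℝ) := by
  classical
  have h : (B ∩ T : Set ι) = ((T.filter (· ∈ B) : Finset ι) : Set ι) := by
    ext; simp [and_comm]
  rw [h, Set.ncard_coe_finset]
  simp [Set.indicator_apply]

theorem sum_compl_indicator_one_eq_ncard (H : Finset ι) (B : Set ι) :
    ∑ i ∈ Hᶜ, B.indicator (fun _ => (1 : ℝ)) i = ((B \ H : Set ι).ncard : ℝ) := by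
  rw [sum_indicator_one_eq_ncard, Finset.coe_compl, sdiff_eq]

theorem convex_hypersimplexSlice (H : Finset ι) (r a b : ℕ) :
    Convex ℝ (hypersimplexSlice H r a b) := by
  rintro x ⟨hx, hxr, hxa, hxb⟩ y ⟨hy, hyr, hya, hyb⟩ α β hα hβ hαβ
  have hsum : ∀ T : Finset ι, ∑ i ∈ T, (α • x + β • y) i = α * ∑ i ∈ T, x i + β * ∑ i ∈ T, y i := by
    intro T
    simp [Finset.sum_add_distrib, Finset.mul_sum]
  have hβ' : β = 1 - α := by linarith
  refine ⟨fun i => ?_, ?_, ?_, ?_⟩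
  · have h1 := hx i
    have h2 := hy i
    simp only [Pi.add_apply, Pi.smul_apply, smul_eq_mul]
    constructor
    · have := mul_nonneg hα h1.1
      have := mul_nonneg hβ h2.1
      linarith
    · have := mul_le_of_le_one_right hα h1.2
      have := mul_le_of_le_one_right hβ h2.2
      linarith
  · rw [hsum, hxr, hyr, ← add_mul, hαβ, one_mul]
  · rw [hsum]
    have := mul_le_mul_of_nonneg_left hxa hα
    have := mul_le_mul_of_nonneg_left hya hβ
    subst hβ'; linarith
  · rw [hsum]
    have := mul_le_mul_of_nonneg_left hxb hα
    have := mul_le_mul_of_nonneg_left hyb hβ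
    subst hβ'; linarith

theorem isCompact_hypersimplexSlice (H : Finset ι) (r a b : ℕ) :
    IsCompact (hypersimplexSlice H r a b) := by
  refine (isCompact_univ_pi fun _ : ι => isCompact_Icc (a := (0 : ℝ)) (b := 1)).of_isClosed_subset
    ?_ fun x hx i _ => hx.1 i
  have : hypersimplexSlice H r a b = (⋂ i, {x : ι → ℝ | 0 ≤ x i ∧ x i ≤ 1}) ∩
      ({x | ∑ i, x i = r} ∩ ({x | (a : ℝ) ≤ ∑ i ∈ Hᶜ, x i} ∩ {x | ∑ i ∈ Hᶜ, x i ≤ b})) := by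
    ext x; simp [hypersimplexSlice]
  rw [this]
  refine (isClosed_iInter fun i => ?_).inter (.inter ?_ (.inter ?_ ?_))
  · exact (isClosed_le continuous_const (continuous_apply i)).inter
      (isClosed_le (continuous_apply i) continuous_const)
  · exact isClosed_eq (by fun_prop) (by fun_prop)
  · exact isClosed_le (by fun_prop) (by fun_prop)
  · exact isClosed_le (by fun_prop) (by fun_prop)

/-- A slice of a hypersimplex between two consecutive integral levels is a lattice polytope. -/
theorem hypersimplexSlice_eq_convexHull (H : Finset ι) (r a b : ℕ) :
    hypersimplexSlice H r a b = convexHull ℝ ((fun B : Set ι => B.indicator (fun _ => (1 : ℝ))) ''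
      {B | B.ncard = r ∧ a ≤ (B \ H : Set ι).ncard ∧ (B \ H : Set ι).ncard ≤ b}) := by
  apply Subset.antisymm
  · have hsub : (hypersimplexSlice H r a b).extremePoints ℝ ⊆
        (fun B : Set ι => B.indicator (fun _ => (1 : ℝ))) ''
          {B | B.ncard = r ∧ a ≤ (B \ H : Set ι).ncard ∧ (B \ H : Set ι).ncard ≤ b} := by
      intro x hx
      have h01 := eq_zero_or_one_of_mem_extremePoints hx
      have hxB : ({i | x i = 1} : Set ι).indicator (fun _ => (1 : ℝ)) = x := by
        ext i
        rcases h01 i with h | h <;> simp [h]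
      obtain ⟨-, hxr, hxa, hxb⟩ := hx.1
      refine ⟨{i | x i = 1}, ?_, hxB⟩
      have hH := sum_compl_indicator_one_eq_ncard H {i | x i = 1}
      have huniv := sum_indicator_one_eq_ncard Finset.univ {i | x i = 1}
      rw [hxB] at hH huniv
      rw [hH] at hxa hxb
      rw [huniv] at hxr
      refine ⟨?_, by exact_mod_cast hxa, by exact_mod_cast hxb⟩
      simpa using hxr
    have hfin := (toFinite {B : Set ι | B.ncard = r ∧ a ≤ (B \ H : Set ι).ncard ∧
      (B \ H : Set ι).ncard ≤ b}).image (fun B : Set ι => B.indicator (fun _ => (1 : ℝ)))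
    -- Krein–Milman yields a closed hull; the hull of finitely many 0/1 points is already closed.
    rw [← closure_convexHull_extremePoints (isCompact_hypersimplexSlice H r a b)
      (convex_hypersimplexSlice H r a b)]
    exact closure_minimal (convexHull_mono hsub) (hfin.isClosed_convexHull ℝ)
  · refine convexHull_min (𝕜 := ℝ) ?_ (convex_hypersimplexSlice H r a b)
    rintro _ ⟨B, ⟨hBr, hBa, hBb⟩, rfl⟩
    refine ⟨fun i => ?_, ?_, ?_, ?_⟩
    · by_cases h : i ∈ B <;> simp [h]
    · rw [sum_indicator_one_eq_ncard]; simpa using hBr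
    · rw [sum_compl_indicator_one_eq_ncard]; exact_mod_cast hBa
    · rw [sum_compl_indicator_one_eq_ncard]; exact_mod_cast hBb

end Slice

/-! ### Base polytopes of the matroid, the panhandle and the relaxation. -/

namespace Matroid

section Polytope

variable {ι : Type*} [Fintype ι] [DecidableEq ι] {M : Matroid ι} {H : Finset ι} {r : ℕ}

omit [Fintype ι] [DecidableEq ι] in
theorem IsBase.ncard_eq_of_eRank_eq {B : Set ι} (hB : M.IsBase B) (hr : M.eRank = r) :
    B.ncard = r := by
  rw [ncard_def, hB.encard_eq_eRank, hr, ENat.toNat_natCast]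

omit [DecidableEq ι] in
theorem IsStressedHyperplane.one_le_ncard_sdiff (hH : M.IsStressedHyperplane (H : Set ι))
    (hr : M.eRank = r) {B : Set ι} (hB : M.IsBase B) : 1 ≤ (B \ H : Set ι).ncard := by
  rw [Nat.one_le_iff_ne_zero, Ne, ncard_eq_zero, sdiff_eq_empty]
  intro hsub
  have h1 := hH.1.2
  have h2 := M.eRk_mono hsub
  rw [hB.eRk_eq_eRank, hr] at h2
  rw [hr] at h1
  have h3 : M.eRk (H : Set ι) ≠ ⊤ := by
    intro h
    rw [h] at h1
    exact absurd h1.symm (by simp)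
  lift M.eRk (H : Set ι) to ℕ using h3 with k
  norm_cast at h1 h2
  omega

-- Stressedness makes B ∩ H independent, and its closure stays in the flat `H`, so the one element
-- off `H` extends it independently.
omit [DecidableEq ι] in
theorem IsStressedHyperplane.isBase_of_ncard_sdiff_eq_one
    (hH : M.IsStressedHyperplane (H : Set ι)) (hE : M.E = Set.univ) (hr : M.eRank = r)
    {B : Set ι} (hB : B.ncard = r) (hBH : (B \ H : Set ι).ncard = 1) : M.IsBase B := by
  obtain ⟨e, he⟩ := ncard_eq_one.1 hBH
  have heB : e ∈ B \ H := he ▸ mem_singleton e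
  have hins : insert e (B ∩ H) = B := by
    rw [← union_singleton, ← he, inter_union_sdiff]
  have hcard : (B ∩ H : Set ι).encard + 1 = M.eRank := by
    rw [← encard_insert_of_notMem (fun h => heB.2 h.2 : e ∉ B ∩ H), hins, hr,
      ← hB, (toFinite B).cast_ncard_eq]
  have hI := hH.2 _ inter_subset_right hcard
  have hcl : M.closure (B ∩ H) ⊆ H := by
    have h := M.closure_subset_closure (inter_subset_right (s := B) (t := (H : Set ι)))
    rwa [hH.1.1.closure] at h
  have hBI : M.Indep B := by
    rw [← hins, hI.insert_indep_iff]
    exact Or.inl ⟨hE ▸ mem_univ e, fun h => heB.2 (hcl h)⟩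
  refine hBI.isBase_of_eRk_ge (toFinite B) ?_
  rw [hBI.eRk_eq_encard, hr, ← hB, (toFinite B).cast_ncard_eq]

theorem IsStressedHyperplane.basePolytope_subset_slice (hH : M.IsStressedHyperplane (H : Set ι))
    (hr : M.eRank = r) : M.basePolytope ⊆ hypersimplexSlice H r 1 r := by
  rw [hypersimplexSlice_eq_convexHull, basePolytope]
  refine convexHull_mono (image_mono fun B hB => ?_)
  have hBr := IsBase.ncard_eq_of_eRank_eq hB hr
  exact ⟨hBr, hH.one_le_ncard_sdiff hr hB, hBr ▸ ncard_le_ncard sdiff_subset⟩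

theorem IsStressedHyperplane.slice_subset_basePolytope (hH : M.IsStressedHyperplane (H : Set ι))
    (hE : M.E = Set.univ) (hr : M.eRank = r) : hypersimplexSlice H r 1 1 ⊆ M.basePolytope := by
  rw [hypersimplexSlice_eq_convexHull, basePolytope]
  exact convexHull_mono (image_mono fun B hB =>
    hH.isBase_of_ncard_sdiff_eq_one hE hr hB.1 (le_antisymm hB.2.2 hB.2.1))

theorem panhandle_basePolytope_eq (hrs : r ≤ (H : Set ι).ncard) :
    (panhandle (H : Set ι) r hrs).basePolytope = hypersimplexSlice H r 0 1 := by
  rw [hypersimplexSlice_eq_convexHull, basePolytope]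
  congr 2
  ext B
  have h := ncard_inter_add_ncard_sdiff_eq_ncard B (H : Set ι)
  simp only [panhandle, Matroid.ofIsBaseOfFinite_isBase, mem_ofPred_eq]
  omega

omit [Fintype ι] [DecidableEq ι] in
theorem relaxation_isBase_iff [M.Finite] (hH : M.IsStressedHyperplane (H : Set ι)) {B : Set ι} :
    (M.relaxation H hH).IsBase B ↔ M.IsBase B ∨ (B ⊆ H ∧ B.encard = M.eRank) := by
  simp [relaxation]

/-- From y to w, ℓ falls linearly from g ≥ 1 to 0. The part with ℓ ≤ 1 lies in the slice; the rest
lies between y and the crossing point with ℓ = 1, which belongs to P_M. -/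
theorem IsStressedHyperplane.segment_subset (hH : M.IsStressedHyperplane (H : Set ι))
    (hE : M.E = Set.univ) (hr : M.eRank = r) {y w : ι → ℝ} (hy : y ∈ M.basePolytope)
    (hw : w ∈ hypersimplexSlice H r 0 0) :
    segment ℝ y w ⊆ M.basePolytope ∪ hypersimplexSlice H r 0 1 := by
  rintro x ⟨α, β, hα, hβ, hαβ, rfl⟩
  have hyS := hH.basePolytope_subset_slice hr hy
  have hy' : y ∈ hypersimplexSlice H r 0 r :=
    ⟨hyS.1, hyS.2.1, (Nat.cast_le.2 zero_le_one).trans hyS.2.2.1, hyS.2.2.2⟩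
  have hw' : w ∈ hypersimplexSlice H r 0 r :=
    ⟨hw.1, hw.2.1, hw.2.2.1, hw.2.2.2.trans (Nat.cast_le.2 (Nat.zero_le r))⟩
  set g : ℝ := ∑ i ∈ Hᶜ, y i with hg
  have hg1 : 1 ≤ g := by simpa using hyS.2.2.1
  have hw0 : ∑ i ∈ Hᶜ, w i = 0 :=
    le_antisymm (by simpa using hw.2.2.2) (by simpa using hw.2.2.1)
  have hsum : ∀ a b : ℝ, ∑ i ∈ Hᶜ, (a • y + b • w) i = a * g := by
    intro a b
    simp [Finset.sum_add_distrib, ← Finset.mul_sum, hw0, hg]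
  have hconv := convex_hypersimplexSlice H r 0 r hy' hw'
  rcases le_or_gt (α * g) 1 with hle | hlt
  · right
    obtain ⟨h1, h2, h3, -⟩ := hconv hα hβ hαβ
    exact ⟨h1, h2, h3, by rw [hsum]; simpa using hle⟩
  · left
    have hα1 : α ≤ 1 := by linarith
    have hgpos : 0 < g := by linarith
    have hgt : 1 < g := hlt.trans_le (mul_le_of_le_one_left hgpos.le hα1)
    have hinv : g⁻¹ ≤ 1 := inv_le_one_of_one_le₀ hg1
    have hv : g⁻¹ • y + (1 - g⁻¹) • w ∈ M.basePolytope := by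
      apply hH.slice_subset_basePolytope hE hr
      obtain ⟨h1, h2, -, -⟩ := hconv (inv_nonneg.2 hgpos.le) (sub_nonneg.2 hinv) (by ring)
      refine ⟨h1, h2, ?_, ?_⟩ <;> rw [hsum, inv_mul_cancel₀ hgpos.ne'] <;> simp
    have hgt' : 0 < g - 1 := by linarith
    -- The weight μ of y against the crossing point solves μg + (1 - μ) = αg, by comparing values of
    -- ℓ.
    have hμ0 : 0 ≤ (α * g - 1) / (g - 1) := div_nonneg (by linarith) hgt'.le
    have hμ1 : 0 ≤ g * (1 - α) / (g - 1) :=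
      div_nonneg (mul_nonneg hgpos.le (by linarith)) hgt'.le
    have hμ : (α * g - 1) / (g - 1) + g * (1 - α) / (g - 1) = 1 := by
      field_simp; ring
    have e1 : α = (α * g - 1) / (g - 1) + g * (1 - α) / (g - 1) * g⁻¹ := by
      field_simp; ring
    have e2 : β = g * (1 - α) / (g - 1) * (1 - g⁻¹) := by
      have : β = 1 - α := by linarith
      rw [this]; field_simp
    have hx : _ ∈ M.basePolytope := convex_convexHull ℝ _ hy hv hμ0 hμ1 hμ
    rwa [smul_add, smul_smul, smul_smul, ← add_assoc, ← add_smul, ← e1, ← e2] at hx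

theorem relaxation_basePolytope_eq [M.Finite] (hH : M.IsStressedHyperplane (H : Set ι))
    (hE : M.E = Set.univ) (hr : M.eRank = r) :
    (M.relaxation H hH).basePolytope = M.basePolytope ∪ hypersimplexSlice H r 0 1 := by
  have hcard : ∀ B : Set ι, B.encard = M.eRank ↔ B.ncard = r := by
    intro B
    rw [hr, ← (toFinite B).cast_ncard_eq, Nat.cast_inj]
  have hbases : {B | (M.relaxation H hH).IsBase B} =
      {B | M.IsBase B} ∪ {B | B.ncard = r ∧ 0 ≤ (B \ H : Set ι).ncard ∧
        (B \ H : Set ι).ncard ≤ 0} := by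
    ext B
    have h0 : (B \ H : Set ι).ncard = 0 ↔ B ⊆ H := by
      rw [ncard_eq_zero, sdiff_eq_empty]
    simp only [mem_ofPred_eq, relaxation_isBase_iff, mem_union, hcard, nonpos_iff_eq_zero,
      h0, zero_le, true_and, and_comm]
  apply Subset.antisymm
  · rw [basePolytope, hbases, image_union]
    -- `convexHull_union` needs nonempty sets; there are no new vertices when `H` has fewer than r
    -- elements.
    rcases eq_empty_or_nonempty {B : Set ι | B.ncard = r ∧ 0 ≤ (B \ H : Set ι).ncard ∧
        (B \ H : Set ι).ncard ≤ 0} with hC | hC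
    · rw [hC, image_empty, union_empty]
      exact subset_union_left
    · rw [convexHull_union ((show {B | M.IsBase B}.Nonempty from M.exists_isBase).image _)
        (hC.image _), ← hypersimplexSlice_eq_convexHull]
      intro x hx
      obtain ⟨y, hy, w, hw, hx⟩ := mem_convexJoin.1 hx
      exact hH.segment_subset hE hr hy hw hx
  · refine union_subset ?_ ?_
    · rw [basePolytope, basePolytope, hbases]
      exact convexHull_mono (image_mono subset_union_left)
    · rw [basePolytope, hbases, hypersimplexSlice_eq_convexHull]
      refine convexHull_mono (image_mono ?_)
      rintro B ⟨hB, -, hB1⟩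
      rcases Nat.le_one_iff_eq_zero_or_eq_one.1 hB1 with h | h
      · exact Or.inr ⟨hB, h.ge, h.le⟩
      · exact Or.inl (hH.isBase_of_ncard_sdiff_eq_one hE hr hB h)

theorem IsStressedHyperplane.basePolytope_inter_slice (hH : M.IsStressedHyperplane (H : Set ι))
    (hE : M.E = Set.univ) (hr : M.eRank = r) :
    M.basePolytope ∩ hypersimplexSlice H r 0 1 = hypersimplexSlice H r 1 1 := by
  apply Subset.antisymm
  · rintro x ⟨hx, h1, h2, -, h4⟩
    exact ⟨h1, h2, (hH.basePolytope_subset_slice hr hx).2.2.1, h4⟩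
  · intro x hx
    exact ⟨hH.slice_subset_basePolytope hE hr hx, hx.1, hx.2.1,
      (Nat.cast_le.2 zero_le_one).trans hx.2.2.1, hx.2.2.2⟩

/-- The functional -ℓ exposes the face; the point `p` shows that the bound ℓ ≥ 1 is attained. -/
theorem IsStressedHyperplane.isExposed_basePolytope (hH : M.IsStressedHyperplane (H : Set ι))
    (hE : M.E = Set.univ) (hr : M.eRank = r) :
    IsExposed ℝ M.basePolytope (hypersimplexSlice H r 1 1) := by
  rintro ⟨p, hp⟩
  refine ⟨-∑ i ∈ Hᶜ, ContinuousLinearMap.proj (R := ℝ) (φ := fun _ : ι => ℝ) i, ?_⟩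
  ext x
  simp only [_root_.neg_apply, _root_.sum_apply,
    ContinuousLinearMap.proj_apply, neg_le_neg_iff]
  constructor
  · intro hx
    exact ⟨hH.slice_subset_basePolytope hE hr hx, fun y hy =>
      hx.2.2.2.trans (hH.basePolytope_subset_slice hr hy).2.2.1⟩
  · rintro ⟨hx, hmin⟩
    have h := hH.basePolytope_subset_slice hr hx
    exact ⟨h.1, h.2.1, h.2.2.1,
      (hmin p (hH.slice_subset_basePolytope hE hr hp)).trans hp.2.2.2⟩

theorem isExposed_hypersimplexSlice :
    IsExposed ℝ (hypersimplexSlice H r 0 1) (hypersimplexSlice H r 1 1) := by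
  rintro ⟨p, hp⟩
  refine ⟨∑ i ∈ Hᶜ, ContinuousLinearMap.proj (R := ℝ) (φ := fun _ : ι => ℝ) i, ?_⟩
  have hmono : hypersimplexSlice H r 1 1 ⊆ hypersimplexSlice H r 0 1 := fun x hx =>
    ⟨hx.1, hx.2.1, (Nat.cast_le.2 zero_le_one).trans hx.2.2.1, hx.2.2.2⟩
  ext x
  simp only [_root_.sum_apply, ContinuousLinearMap.proj_apply]
  constructor
  · intro hx
    exact ⟨hmono hx, fun y hy => hy.2.2.2.trans hx.2.2.1⟩
  · rintro ⟨hx, hmax⟩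
    exact ⟨hx.1, hx.2.1, hp.2.2.1.trans (hmax p (hmono hp)), hx.2.2.2⟩

end Polytope

end Matroid

/-! ### Lattice point counts. -/

section Counting

open PowerSeries in
/-- The number of functions with values in `{0, …, t}` and sum `k`, by inclusion-exclusion. -/
theorem card_piFinset_range_sum_eq (ι : Type*) [Fintype ι] [DecidableEq ι] (t k : ℕ)
    (hι : 0 < Fintype.card ι) :
    (((Fintype.piFinset fun _ : ι => Finset.range (t + 1)).filter
        fun f => ∑ i, f i = k).card : ℤ) =
      ∑ i ∈ Finset.range (Fintype.card ι + 1), if (t + 1) * i ≤ k then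
        (-1 : ℤ) ^ i * ((Fintype.card ι).choose i : ℤ) *
          ((Fintype.card ι - 1 + (k - (t + 1) * i)).choose (Fintype.card ι - 1) : ℤ) else 0 := by
  set d := Fintype.card ι
  -- The count is the coefficient of X^k in (1 + X + ⋯ + X^t)^d = (1 - X^(t+1))^d (1 - X)^(-d).
  have h1 : coeff k ((∑ j ∈ Finset.range (t + 1), (X : ℤ⟦X⟧) ^ j) ^ d) =
      (((Fintype.piFinset fun _ : ι => Finset.range (t + 1)).filter
        fun f => ∑ i, f i = k).card : ℤ) := by
    have : (∑ j ∈ Finset.range (t + 1), (X : ℤ⟦X⟧) ^ j) ^ d =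
        ∏ _i : ι, ∑ j ∈ Finset.range (t + 1), (X : ℤ⟦X⟧) ^ j := by
      rw [Finset.prod_const, Finset.card_univ]
    rw [this, Finset.prod_univ_sum]
    simp [Finset.prod_pow_eq_pow_sum, coeff_X_pow, eq_comm]
  have h2 : (∑ j ∈ Finset.range (t + 1), (X : ℤ⟦X⟧) ^ j) ^ d =
      (1 - X ^ (t + 1)) ^ d * (invOneSubPow ℤ d).val := by
    have h := (invOneSubPow ℤ d).inv_val
    rw [invOneSubPow_inv_eq_one_sub_pow] at h
    calc _ = ((∑ j ∈ Finset.range (t + 1), (X : ℤ⟦X⟧) ^ j) * (1 - X)) ^ d *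
          (invOneSubPow ℤ d).val := by rw [mul_pow, mul_assoc, h, mul_one]
      _ = _ := by rw [geom_sum_mul_neg]
  have h3 : ((1 : ℤ⟦X⟧) - X ^ (t + 1)) ^ d =
      ∑ i ∈ Finset.range (d + 1), C ((-1 : ℤ) ^ i * (d.choose i : ℤ)) * X ^ ((t + 1) * i) := by
    rw [sub_eq_neg_add, add_pow]
    refine Finset.sum_congr rfl fun i _ => ?_
    rw [neg_pow, ← pow_mul]
    simp
    ring
  rw [← h1, h2, h3, Finset.sum_mul, map_sum]
  refine Finset.sum_congr rfl fun i _ => ?_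
  rw [mul_assoc, coeff_C_mul, coeff_X_pow_mul',
    invOneSubPow_val_eq_mk_sub_one_add_choose_of_pos _ _ hι]
  split_ifs <;> simp [mul_assoc]

/-- For k ≤ t the upper bounds are vacuous, so only the term i = 0 survives. -/
theorem card_piFinset_range_sum_eq_of_le (ι : Type*) [Fintype ι] [DecidableEq ι] (t k : ℕ)
    (hι : 0 < Fintype.card ι) (hk : k ≤ t) :
    (((Fintype.piFinset fun _ : ι => Finset.range (t + 1)).filter
        fun f => ∑ i, f i = k).card : ℤ) = ((k + (Fintype.card ι - 1)).choose k : ℤ) := by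
  rw [card_piFinset_range_sum_eq ι t k hι, Finset.sum_eq_single 0]
  · simp [add_comm k, Nat.choose_symm_add]
  · intro i _ hi
    rw [if_neg]
    have := Nat.mul_le_mul_left (t + 1) (Nat.one_le_iff_ne_zero.2 hi)
    omega
  · simp

theorem card_piFinset_range_sum_eq_codegree (ι : Type*) [Fintype ι] [DecidableEq ι]
    {r s t m : ℕ} (hs : Fintype.card ι = s) (hr : 0 < r) (hrs : r ≤ s) (hm : m < t) :
    (((Fintype.piFinset fun _ : ι => Finset.range (t + 1)).filter
        fun f => ∑ i, f i = t * (s - r) + m).card : ℤ) =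
      ∑ i ∈ Finset.range (s + 1 - r), (-1 : ℤ) ^ i * (s.choose i : ℤ) *
        ((t * (s - r - i) + m + (s - 1 - i)).choose (s - 1) : ℤ) := by
  rw [card_piFinset_range_sum_eq ι t _ (by omega), hs]
  symm
  refine Finset.sum_subset_zero_on_sdiff (Finset.range_mono (by omega)) ?_ ?_
  · intro i hi
    simp only [Finset.mem_sdiff, Finset.mem_range] at hi
    rw [if_neg]
    -- As m < t, already (t + 1)(s - r + 1) exceeds t(s - r) + m, which cuts the sum at i = s - r.
    have := Nat.mul_le_mul_left (t + 1) (show s - r + 1 ≤ i by omega)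
    have e : (t + 1) * (s - r + 1) = t * (s - r) + t + (s - r) + 1 := by ring
    omega
  · intro i hi
    rw [Finset.mem_range] at hi
    obtain ⟨c, hc⟩ : ∃ c, s - r = i + c := ⟨s - r - i, by omega⟩
    have h1 : s - r - i = c := by omega
    have e1 : t * (i + c) = t * i + t * c := by ring
    have e2 : (t + 1) * i = t * i + i := by ring
    rw [h1, hc, e1, e2]
    split_ifs with h
    · congr 3
      omega
    -- Where the inclusion-exclusion guard fails, the upper index is below s - 1 and the binomial
    -- vanishes by itself.
    · rw [Nat.choose_eq_zero_of_lt (k := s - 1) (by omega)]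
      simp

/-- The integer points of the dilated half-open slice, sorted by their coordinate sum outside
`H`. -/
theorem ncard_slice_int_points {ι : Type*} [Fintype ι] [DecidableEq ι] (H : Finset ι) {r : ℕ}
    (t : ℕ) (hr : 0 < r) (hrs : r ≤ H.card) (hs : H.card < Fintype.card ι) :
    ((Set.ncard {z : ι → ℤ | (∀ i, 0 ≤ z i ∧ z i ≤ t) ∧ ∑ i, z i = t * r ∧
        ∑ i ∈ Hᶜ, z i < t} : ℕ) : ℤ) =
      ∑ m ∈ Finset.range t, ∑ i ∈ Finset.range (H.card + 1 - r),
        (-1 : ℤ) ^ i * (H.card.choose i : ℤ) *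
          ((t * (H.card - r - i) + m + (H.card - 1 - i)).choose (H.card - 1) : ℤ) *
          ((m + (Fintype.card ι - H.card - 1)).choose m : ℤ) := by
  -- Reflecting z ↦ t - z on `H` turns the sum tr - m there into t(s - r) + m.
  set A : ℕ → Finset ({i // i ∈ H} → ℕ) := fun m =>
    (Fintype.piFinset fun _ => Finset.range (t + 1)).filter
      fun f => ∑ i, f i = t * (H.card - r) + m with hA
  set B : ℕ → Finset ({i // i ∉ H} → ℕ) := fun m =>
    (Fintype.piFinset fun _ => Finset.range (t + 1)).filter fun f => ∑ i, f i = m with hB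
  set F := (Finset.range t).sigma fun m => A m ×ˢ B m with hF
  let Φ : (Σ _ : ℕ, ({i // i ∈ H} → ℕ) × ({i // i ∉ H} → ℕ)) → ι → ℤ := fun p i =>
    if h : i ∈ H then (t : ℤ) - p.2.1 ⟨i, h⟩ else p.2.2 ⟨i, h⟩
  have hΦ1 : ∀ p (x : {i // i ∈ H}), Φ p x = (t : ℤ) - p.2.1 x := fun p x => by
    simp [Φ, x.2]
  have hΦ2 : ∀ p (x : {i // i ∉ H}), Φ p x = p.2.2 x := fun p x => by
    simp [Φ, x.2]
  have hsumH : ∀ z : ι → ℤ, ∑ i ∈ H, z i = ∑ x : {i // i ∈ H}, z x := fun z =>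
    Finset.sum_subtype H (fun _ => Iff.rfl) z
  have hsumHc : ∀ z : ι → ℤ, ∑ i ∈ Hᶜ, z i = ∑ x : {i // i ∉ H}, z x := fun z =>
    Finset.sum_subtype Hᶜ (fun _ => Finset.mem_compl) z
  have hcast : (t : ℤ) * ((H.card - r : ℕ) : ℤ) = t * H.card - t * r := by
    push_cast [Nat.cast_sub hrs]; ring
  have himage : {z : ι → ℤ | (∀ i, 0 ≤ z i ∧ z i ≤ t) ∧ ∑ i, z i = t * r ∧
        ∑ i ∈ Hᶜ, z i < t} = Φ '' F := by
    ext z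
    constructor
    · rintro ⟨hz, hzr, hzt⟩
      have hnn : 0 ≤ ∑ i ∈ Hᶜ, z i := Finset.sum_nonneg fun i _ => (hz i).1
      rw [← Finset.sum_add_sum_compl H] at hzr
      have hc1 : ∀ i, (((t : ℤ) - z i).toNat : ℤ) = t - z i := fun i =>
        Int.toNat_of_nonneg (by linarith [(hz i).2])
      have hc2 : ∀ i, ((z i).toNat : ℤ) = z i := fun i => Int.toNat_of_nonneg (hz i).1
      refine ⟨⟨(∑ i ∈ Hᶜ, z i).toNat, fun x => ((t : ℤ) - z x).toNat, fun x => (z x).toNat⟩,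
        ?_, ?_⟩
      · simp only [hF, hA, hB, Finset.coe_sigma, Set.mem_sigma_iff, Finset.mem_coe,
          Finset.mem_range, Finset.mem_product, Finset.mem_filter, Fintype.mem_piFinset]
        refine ⟨by omega, ⟨fun x => ?_, ?_⟩, fun x => ?_, ?_⟩
        · have := hz x
          omega
        · zify
          rw [hcast]
          simp only [hc1, Int.toNat_of_nonneg hnn]
          rw [Finset.sum_sub_distrib, ← hsumH]
          simp only [Finset.sum_const, Finset.card_univ, Fintype.card_coe, nsmul_eq_mul]
          linarith
        · have := hz x
          omega
        · zify
          simp only [hc2, Int.toNat_of_nonneg hnn]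
          exact (hsumHc z).symm
      · ext i
        by_cases h : i ∈ H
        · simp only [Φ, dif_pos h, hc1]; ring
        · simp only [Φ, dif_neg h, hc2]
    · rintro ⟨⟨m, f, g⟩, hp, rfl⟩
      simp only [hF, hA, hB, Finset.coe_sigma, Set.mem_sigma_iff, Finset.mem_coe,
        Finset.mem_range, Finset.mem_product, Finset.mem_filter, Fintype.mem_piFinset] at hp
      obtain ⟨hm, ⟨hf, hfs⟩, hg, hgs⟩ := hp
      zify at hfs hgs
      rw [hcast] at hfs
      have h1 : ∑ i ∈ Hᶜ, Φ ⟨m, f, g⟩ i = m := by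
        rw [hsumHc, ← hgs]
        exact Finset.sum_congr rfl fun x _ => hΦ2 _ x
      refine ⟨fun i => ?_, ?_, by rw [h1]; exact_mod_cast hm⟩
      · by_cases h : i ∈ H
        · have := hf ⟨i, h⟩
          simp only [Φ, dif_pos h]
          omega
        · have := hg ⟨i, h⟩
          simp only [Φ, dif_neg h]
          omega
      · rw [← Finset.sum_add_sum_compl H, h1, hsumH]
        simp only [hΦ1]
        rw [Finset.sum_sub_distrib, hfs]
        simp only [Finset.sum_const, Finset.card_univ, Fintype.card_coe, nsmul_eq_mul]
        ring
  have hinj : Set.InjOn Φ F := by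
    rintro ⟨m, f, g⟩ hp ⟨m', f', g'⟩ hp' heq
    simp only [hF, hA, hB, Finset.coe_sigma, Set.mem_sigma_iff, Finset.mem_coe,
      Finset.mem_range, Finset.mem_product, Finset.mem_filter, Fintype.mem_piFinset] at hp hp'
    have hf : f = f' := by
      ext x
      have := congrFun heq x
      rw [hΦ1, hΦ1] at this
      simpa using this
    have hg : g = g' := by
      ext x
      have := congrFun heq x
      rw [hΦ2, hΦ2] at this
      simpa using this
    subst hf hg
    obtain rfl : m = m' := hp.2.2.2.symm.trans hp'.2.2.2
    rfl
  rw [himage, hinj.ncard_image, Set.ncard_coe_finset, hF, Finset.card_sigma,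
    Nat.cast_sum]
  refine Finset.sum_congr rfl fun m hm => ?_
  rw [Finset.mem_range] at hm
  have hcc : Fintype.card {i // i ∉ H} = Fintype.card ι - H.card := by
    rw [Fintype.card_subtype_compl, Fintype.card_coe]
  rw [Finset.card_product, Nat.cast_mul,
    card_piFinset_range_sum_eq_codegree _ (Fintype.card_coe H) hr hrs hm,
    card_piFinset_range_sum_eq_of_le _ t m (by omega) hm.le, hcc, Finset.sum_mul]

end Counting

/-! ### The Ehrhart difference. -/

namespace Matroid

section Ehrhart

variable {ι : Type*} [Fintype ι] [DecidableEq ι] {M : Matroid ι} {H : Finset ι} {r : ℕ}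

/-- The top level ℓ = 1 of the slice is already in P_M, and nothing below it is. -/
theorem mem_relaxation_basePolytope_sdiff_iff [M.Finite]
    (hH : M.IsStressedHyperplane (H : Set ι)) (hE : M.E = Set.univ) (hr : M.eRank = r)
    {x : ι → ℝ} :
    x ∈ (M.relaxation H hH).basePolytope \ M.basePolytope ↔
      (∀ i, 0 ≤ x i ∧ x i ≤ 1) ∧ ∑ i, x i = r ∧ ∑ i ∈ Hᶜ, x i < 1 := by
  rw [relaxation_basePolytope_eq hH hE hr, union_sdiff_left]
  constructor
  · rintro ⟨⟨h1, h2, h3, h4⟩, hx⟩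
    refine ⟨h1, h2, lt_of_not_ge fun h => hx (hH.slice_subset_basePolytope hE hr ?_)⟩
    exact ⟨h1, h2, by simpa using h, h4⟩
  · rintro ⟨h1, h2, h3⟩
    refine ⟨⟨h1, h2, ?_, by simpa using h3.le⟩, fun hx => ?_⟩
    · simpa using Finset.sum_nonneg fun i (_ : i ∈ Hᶜ) => (h1 i).1
    · have := (hH.basePolytope_subset_slice hr hx).2.2.1
      rw [Nat.cast_one] at this
      linarith

theorem relaxation_basePolytope_subset_Icc [M.Finite] (hH : M.IsStressedHyperplane (H : Set ι))
    (hE : M.E = Set.univ) (hr : M.eRank = r) {x : ι → ℝ}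
    (hx : x ∈ (M.relaxation H hH).basePolytope) (i : ι) : 0 ≤ x i ∧ x i ≤ 1 := by
  rw [relaxation_basePolytope_eq hH hE hr] at hx
  rcases hx with hx | hx
  · exact (hH.basePolytope_subset_slice hr hx).1 i
  · exact hx.1 i

theorem ehrhart_relaxation_eq_add_ncard [M.Finite] (hH : M.IsStressedHyperplane (H : Set ι))
    (hE : M.E = Set.univ) (hr : M.eRank = r) {t : ℕ} (ht : 0 < t) :
    ehrhart (M.relaxation H hH).basePolytope t = ehrhart M.basePolytope t +
      Set.ncard {z : ι → ℤ | (∀ i, 0 ≤ z i ∧ z i ≤ t) ∧ ∑ i, z i = t * r ∧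
        ∑ i ∈ Hᶜ, z i < t} := by
  have ht0 : (0 : ℝ) < t := by exact_mod_cast ht
  have hmem : ∀ (P : Set (ι → ℝ)) (z : ι → ℤ), (fun i => (z i : ℝ)) ∈ (t : ℝ) • P ↔
      (fun i => (z i : ℝ) / t) ∈ P := by
    intro P z
    rw [mem_smul_set_iff_inv_smul_mem₀ ht0.ne']
    have : ((t : ℝ)⁻¹ • fun i => (z i : ℝ)) = fun i => (z i : ℝ) / t := by
      ext i
      simp [div_eq_inv_mul]
    rw [this]
  simp only [ehrhart, hmem]
  set S := {z : ι → ℤ | (fun i => (z i : ℝ) / t) ∈ (M.relaxation H hH).basePolytope} with hS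
  set S' := {z : ι → ℤ | (fun i => (z i : ℝ) / t) ∈ M.basePolytope} with hS'
  have hbox : ∀ z : ι → ℤ, ∀ i, (0 ≤ (z i : ℝ) / t ∧ (z i : ℝ) / t ≤ 1) ↔
      (0 ≤ z i ∧ z i ≤ t) := by
    intro z i
    rw [le_div_iff₀ ht0, zero_mul, div_le_one ht0]
    norm_cast
  -- Without finiteness `ncard` would not be additive over S' and S \ S'.
  have hfin : S.Finite := by
    refine (Set.Finite.pi' fun _ : ι => Set.finite_Icc (0 : ℤ) t).subset fun z hz i => ?_
    exact (hbox z i).1 (relaxation_basePolytope_subset_Icc hH hE hr hz i)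
  have hsub : S' ⊆ S := fun z hz => by
    simp only [hS, relaxation_basePolytope_eq hH hE hr]
    exact Or.inl hz
  have hdiff : S \ S' = {z : ι → ℤ | (∀ i, 0 ≤ z i ∧ z i ≤ t) ∧ ∑ i, z i = t * r ∧
      ∑ i ∈ Hᶜ, z i < t} := by
    ext z
    have h := mem_relaxation_basePolytope_sdiff_iff hH hE hr (x := fun i => (z i : ℝ) / t)
    refine Iff.trans h ?_
    simp only [hbox, ← Finset.sum_div]
    rw [div_eq_iff ht0.ne', div_lt_one ht0, mul_comm (r : ℝ)]
    norm_cast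
  rw [← hdiff, add_comm, Set.ncard_sdiff_add_ncard_of_subset hsub hfin]

omit [Fintype ι] [DecidableEq ι] in
theorem basePolytope_nonempty (M : Matroid ι) : M.basePolytope.Nonempty :=
  ((show {B | M.IsBase B}.Nonempty from M.exists_isBase).image _).convexHull

end Ehrhart

end Matroid

/-! ### Assembly. -/

theorem mainTheorem4 (n r s : ℕ) (M : Matroid (Fin n)) (hE : M.E = Set.univ)
    (hr : M.eRank = r) (H : Finset (Fin n)) (hs : H.card = s)
    (hH : M.IsStressedHyperplane (H : Set (Fin n))) :
    -- the Ehrhart function; all natural subtractions below are exact, and the inner sum runs over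
    -- `0 ≤ i ≤ s - r` (it is empty in the case `s = r - 1`)
    (∀ t : ℕ,
      (ehrhart (M.relaxation H hH).basePolytope t : ℤ) =
        ehrhart M.basePolytope t +
          ∑ m ∈ Finset.range t, ∑ i ∈ Finset.range (s + 1 - r),
            (-1 : ℤ) ^ i * (s.choose i : ℤ) *
              ((t * (s - r - i) + m + (s - 1 - i)).choose (s - 1) : ℤ) *
              ((m + (n - s - 1)).choose m : ℤ)) ∧
    -- the decomposition of the base polytope of the relaxation
    (∀ hrs : r ≤ (H : Set (Fin n)).ncard,
      (M.relaxation H hH).basePolytope =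
        M.basePolytope ∪ (Matroid.panhandle (H : Set (Fin n)) r hrs).basePolytope ∧
      M.basePolytope ∩ (Matroid.panhandle (H : Set (Fin n)) r hrs).basePolytope =
        {x : Fin n → ℝ | (∀ i, 0 ≤ x i ∧ x i ≤ 1) ∧ ∑ i, x i = r ∧ ∑ i ∈ Hᶜ, x i = 1} ∧
      IsExposed ℝ M.basePolytope
        (M.basePolytope ∩ (Matroid.panhandle (H : Set (Fin n)) r hrs).basePolytope) ∧
      IsExposed ℝ (Matroid.panhandle (H : Set (Fin n)) r hrs).basePolytope
        (M.basePolytope ∩ (Matroid.panhandle (H : Set (Fin n)) r hrs).basePolytope)) := by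
  subst hs
  refine ⟨fun t => ?_, fun hrs => ?_⟩
  · rcases Nat.eq_zero_or_pos t with rfl | ht
    -- For t = 0 both dilates are {0}, as base polytopes are nonempty.
    · simp [ehrhart, Set.zero_smul_set (Matroid.basePolytope_nonempty _)]
    rcases lt_or_ge H.card r with hlt | hrs
    -- With fewer than r elements `H` contributes no new basis, and the inner sum is empty.
    · have hbases : {B | (M.relaxation H hH).IsBase B} = {B | M.IsBase B} := by
        ext B
        refine (Matroid.relaxation_isBase_iff hH).trans (or_iff_left ?_)
        rintro ⟨hBH, hB⟩
        have h := encard_le_encard hBH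
        rw [hB, hr, encard_coe_eq_coe_finsetCard] at h
        exact absurd (Nat.cast_le.1 h) (by omega)
      rw [Matroid.basePolytope, hbases, ← Matroid.basePolytope,
        show H.card + 1 - r = 0 by omega]
      simp
    · obtain ⟨B, hB⟩ := M.exists_isBase
      -- An element of a basis off `H` gives both r > 0 and s < n.
      have h1 := hH.one_le_ncard_sdiff hr hB
      have hr0 : 0 < r :=
        Matroid.IsBase.ncard_eq_of_eRank_eq hB hr ▸ h1.trans (ncard_le_ncard sdiff_subset)
      have hcard : H.card < Fintype.card (Fin n) := by
        refine H.card_lt_univ_of_notMem (x := ?_) ?_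
        · exact (Set.nonempty_of_ncard_ne_zero (Nat.one_le_iff_ne_zero.1 h1)).some
        · exact (Set.nonempty_of_ncard_ne_zero (Nat.one_le_iff_ne_zero.1 h1)).some_mem.2
      rw [Matroid.ehrhart_relaxation_eq_add_ncard hH hE hr ht, Nat.cast_add,
        ncard_slice_int_points H t hr0 hrs hcard, Fintype.card_fin]
  · rw [Matroid.panhandle_basePolytope_eq, hH.basePolytope_inter_slice hE hr]
    refine ⟨Matroid.relaxation_basePolytope_eq hH hE hr, ?_,
      hH.isExposed_basePolytope hE hr, Matroid.isExposed_hypersimplexSlice⟩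
    ext x
    simp only [hypersimplexSlice, Nat.cast_one, mem_ofPred_eq]
    rw [← ge_antisymm_iff]
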